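/- Let $S^1\subset\mathbb{C}$ be the unit circle with its standard smooth structure and let $Z\subset S^1$ be a finite set of points (possibly empty). A vector field on an open set $U\subseteq S^1$ is called a $b$-vector field if it is smooth and tangent to $Z$, that is, if it vanishes at every point of $Z\cap U$. A $b$-tangent bundle of $(S^1,Z)$ is a smooth real vector bundle $E\to S^1$ of finite rank together with a smooth vector bundle morphism $\rho\colon E\to TS^1$ over the identity such that, for every open set $U\subseteq S^1$, the map $s\mapsto\rho\circ s$ is a bijection from the smooth sections of $E$ over $U$ onto the $b$-vector fields on $U$; in other words, the sheaf of smooth sections of $E$ is the sheaf of $b$-vector fields. An isomorphism of smooth vector bundles means one covering the identity of $S^1$. Let ${}^bTS^1$ be the line bundle obtained by gluing the trivial line bundles over $U_0=S^1\setminus Z$ and, for $z\in Z$, over $U_z=\{p\in S^1:\operatorname{Re}(p/z)>0\}\setminus(Z\setminus\{z\})$, where, with $f_0=1$ and $f_z(p)=\operatorname{Im}(p/z)$, the fibre coordinates $a$ over $U_i$ and $a'$ over $U_j$ ($i\ne j$) are related over $U_i\cap U_j$ by $a'=(f_i/f_j)\,a$ (so that the constant section $1$ over $U_i$ represents the vector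 field $f_i\,\partial/\partial\theta$). Then: 1. ${}^bTS^1$ is a $b$-tangent bundle of $(S^1,Z)$. 2. ${}^bTS^1\cong TS^1$ as smooth vector bundles if and only if $\#Z$ is even. 3. More generally, for every $b$-tangent bundle $E$ of $(S^1,Z)$, $E\cong TS^1$ as smooth vector bundles if and only if $\#Z$ is even. -/

import Mathlib

open Set Bundle
open scoped Manifold ContDiff

section General

variable {EM : Type*} [NormedAddCommGroup EM] [NormedSpace ℝ EM]
  {H : Type*} [TopologicalSpace H] (I : ModelWithCorners ℝ EM H)
  {M : Type*} [TopologicalSpace M] [ChartedSpace H M]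

/-- The vector field `X` is tangent to the embedded closed submanifold `Z` over the open set `U`:
for every smooth function `f` on an open subset `V` of `U` that vanishes on `Z ∩ V`, the
derivative of `f` along `X` vanishes on `Z ∩ V`.  (If `Z` is a discrete set of points this says
that `X` vanishes at the points of `Z ∩ U`.) -/
def IsTangentOn (Z U : Set M) (X : ∀ p : M, TangentSpace I p) : Prop :=
  ∀ V : Set M, IsOpen V → V ⊆ U → ∀ f : M → ℝ, ContMDiffOn I 𝓘(ℝ, ℝ) ∞ f V →
    (∀ p ∈ Z ∩ V, f p = 0) → ∀ p ∈ Z ∩ V, mfderiv I 𝓘(ℝ, ℝ) f p (X p) = 0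

/-- `X` is a `b`-vector field over the open set `U`: it is smooth on `U` and tangent to `Z`. -/
def IsBVectorField [IsManifold I 1 M] (Z U : Set M) (X : ∀ p : M, TangentSpace I p) : Prop :=
  ContMDiffOn I I.tangent ∞ (fun p => (⟨p, X p⟩ : TangentBundle I M)) U ∧ IsTangentOn I Z U X

/-- The smooth vector bundle `E` over `M` is a `b`-tangent bundle of `(M, Z)`: there is a smooth
vector bundle morphism `ρ : E → TM` over the identity (the anchor) such that, over every open set
`U`, composition with `ρ` is a bijection from the smooth sections of `E` over `U` onto the
`b`-vector fields over `U`.  In other words `ρ` identifies the sheaf of smooth sections of `E`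
with the sheaf of vector fields tangent to `Z`. -/
def IsBTangentBundle [IsManifold I 1 M] (Z : Set M)
    (F : Type*) [NormedAddCommGroup F] [NormedSpace ℝ F]
    (E : M → Type*) [TopologicalSpace (TotalSpace F E)] [∀ p, AddCommGroup (E p)]
    [∀ p, Module ℝ (E p)] [∀ p, TopologicalSpace (E p)] [FiberBundle F E] [VectorBundle ℝ F E] :
    Prop :=
  ∃ ρ : ∀ p : M, E p →ₗ[ℝ] TangentSpace I p,
    ContMDiff (I.prod 𝓘(ℝ, F)) I.tangent ∞
      (fun v : TotalSpace F E => (⟨v.proj, ρ v.proj v.snd⟩ : TangentBundle I M)) ∧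
    ∀ U : Set M, IsOpen U →
      -- sections of `E` over `U` are mapped to `b`-vector fields
      (∀ s : ∀ p, E p,
        ContMDiffOn I (I.prod 𝓘(ℝ, F)) ∞ (fun p => TotalSpace.mk' F p (s p)) U →
          IsBVectorField I Z U (fun p => ρ p (s p))) ∧
      -- injectivity over `U`
      (∀ s t : ∀ p, E p,
        ContMDiffOn I (I.prod 𝓘(ℝ, F)) ∞ (fun p => TotalSpace.mk' F p (s p)) U →
        ContMDiffOn I (I.prod 𝓘(ℝ, F)) ∞ (fun p => TotalSpace.mk' F p (t p)) U →
          (∀ p ∈ U, ρ p (s p) = ρ p (t p)) → ∀ p ∈ U, s p = t p) ∧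
      -- surjectivity onto the `b`-vector fields over `U`
      (∀ X : ∀ p : M, TangentSpace I p, IsBVectorField I Z U X →
        ∃ s : ∀ p, E p,
          ContMDiffOn I (I.prod 𝓘(ℝ, F)) ∞ (fun p => TotalSpace.mk' F p (s p)) U ∧
            ∀ p ∈ U, ρ p (s p) = X p)

/-- The smooth vector bundles `E₁` and `E₂` over `M` are isomorphic: there is a family of linear
isomorphisms of the fibres which is smooth, with smooth inverse, as a map of total spaces. -/
def SmoothVectorBundleIsomorphic
    (F₁ : Type*) [NormedAddCommGroup F₁] [NormedSpace ℝ F₁]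
    (E₁ : M → Type*) [TopologicalSpace (TotalSpace F₁ E₁)] [∀ p, AddCommGroup (E₁ p)]
    [∀ p, Module ℝ (E₁ p)] [∀ p, TopologicalSpace (E₁ p)] [FiberBundle F₁ E₁]
    [VectorBundle ℝ F₁ E₁]
    (F₂ : Type*) [NormedAddCommGroup F₂] [NormedSpace ℝ F₂]
    (E₂ : M → Type*) [TopologicalSpace (TotalSpace F₂ E₂)] [∀ p, AddCommGroup (E₂ p)]
    [∀ p, Module ℝ (E₂ p)] [∀ p, TopologicalSpace (E₂ p)] [FiberBundle F₂ E₂]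
    [VectorBundle ℝ F₂ E₂] : Prop :=
  ∃ Φ : ∀ p : M, E₁ p ≃ₗ[ℝ] E₂ p,
    ContMDiff (I.prod 𝓘(ℝ, F₁)) (I.prod 𝓘(ℝ, F₂)) ∞
      (fun v : TotalSpace F₁ E₁ => TotalSpace.mk' F₂ v.proj (Φ v.proj v.snd)) ∧
    ContMDiff (I.prod 𝓘(ℝ, F₂)) (I.prod 𝓘(ℝ, F₁)) ∞
      (fun v : TotalSpace F₂ E₂ => TotalSpace.mk' F₁ v.proj ((Φ v.proj).symm v.snd))

end General

noncomputable section CircleBundle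

/-- The open cover used for gluing: the complement of `Z`, and for each `z ∈ Z` the open half
circle centred at `z` with the other points of `Z` removed. -/
def bBaseSet (Z : Finset Circle) : Option Z → Set Circle
  | none => {p | p ∉ Z}
  | some z => {p | 0 < ((p / z.1 : Circle) : ℂ).re ∧ p ∉ (Z : Set Circle) \ {z.1}}

/-- The local defining functions of `Z` on the sets of the cover: `1` off `Z`, and the sine of
the angle from `z` to `p` around `z ∈ Z`. -/
def bDefFun (Z : Finset Circle) : Option Z → Circle → ℝ
  | none, _ => 1
  | some z, p => ((p / z.1 : Circle) : ℂ).im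

theorem bBaseSet_isOpen (Z : Finset Circle) (i : Option Z) : IsOpen (bBaseSet Z i) := by
  cases i with
  | none => exact (Z.finite_toSet.isClosed (X := Circle)).isOpen_compl
  | some z =>
    refine IsOpen.inter ?_ ((Z.finite_toSet.subset sdiff_subset).isClosed.isOpen_compl)
    have h : Continuous fun p : Circle => ((p / z.1 : Circle) : ℂ).re := by
      simp only [Circle.coe_div]
      fun_prop
    exact isOpen_lt continuous_const h

theorem bDefFun_ne_zero (Z : Finset Circle) (i : Option Z) (p : Circle) (hp : p ∈ bBaseSet Z i)
    (hpZ : p ∉ Z) : bDefFun Z i p ≠ 0 := by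
  cases i with
  | none => simp [bDefFun]
  | some z =>
    intro h
    apply hpZ
    have h1 : p / z.1 = 1 := by
      apply Circle.ext
      have hn := Circle.normSq_coe (p / z.1)
      simp only [bDefFun] at h
      rw [Complex.normSq_apply, h] at hn
      have h0 := hp.1
      apply Complex.ext
      · simp only [Circle.coe_one, Complex.one_re]
        nlinarith
      · simpa using h
    rw [div_eq_one.mp h1]
    exact z.2

theorem notMem_of_mem_bBaseSet (Z : Finset Circle) {i j : Option Z} (hij : i ≠ j) {p : Circle}
    (hi : p ∈ bBaseSet Z i) (hj : p ∈ bBaseSet Z j) : p ∉ Z := by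
  intro hp
  have key : ∀ k : Option Z, p ∈ bBaseSet Z k → k = some ⟨p, hp⟩ := by
    intro k hk
    cases k with
    | none => exact absurd hp hk
    | some z =>
      by_contra hne
      exact hk.2 ⟨hp, fun h => hne (congrArg some (Subtype.ext (Set.mem_singleton_iff.mp h).symm))⟩
  exact hij ((key i hi).trans (key j hj).symm)

open Classical in
/-- The transition function from index `i` to index `j`; it is the identity if `i = j`, and
`f i / f j` on the overlap otherwise, `f` being the local defining functions.  Thus the local
frame `i` stands for the `b`-vector field `f i • ∂/∂θ`. -/
def bTransition (Z : Finset Circle) (i j : Option Z) (p : Circle) : ℝ :=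
  if i = j then 1 else bDefFun Z i p / bDefFun Z j p

theorem contMDiff_bDefFun (Z : Finset Circle) (i : Option Z) :
    ContMDiff (𝓡 1) 𝓘(ℝ, ℝ) ∞ (bDefFun Z i) := by
  have : Fact (Module.finrank ℝ ℂ = 1 + 1) := finrank_real_complex_fact'
  cases i with
  | none => exact contMDiff_const
  | some z =>
    have h1 : ContMDiff (𝓡 1) 𝓘(ℝ, ℂ) ∞ (fun p : Circle => (p : ℂ)) := contMDiff_coe_sphere
    have h2 : ContDiff ℝ ∞ (fun w : ℂ => (w / (z.1 : ℂ)).im) :=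
      Complex.imCLM.contDiff.comp (contDiff_id.div_const _)
    have h3 := h2.contMDiff.comp h1
    refine h3.congr fun p => ?_
    simp [bDefFun]

theorem contMDiffOn_bTransition (Z : Finset Circle) (i j : Option Z) :
    ContMDiffOn (𝓡 1) 𝓘(ℝ, ℝ) ∞ (bTransition Z i j) (bBaseSet Z i ∩ bBaseSet Z j) := by
  by_cases hij : i = j
  · have : bTransition Z i j = fun _ => 1 := by
      funext p
      simp [bTransition, hij]
    rw [this]
    exact contMDiffOn_const
  · have : bTransition Z i j = fun p => bDefFun Z i p / bDefFun Z j p := by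
      funext p
      simp [bTransition, hij]
    rw [this]
    exact (contMDiff_bDefFun Z i).contMDiffOn.div₀ (contMDiff_bDefFun Z j).contMDiffOn
      fun p hp => bDefFun_ne_zero Z j p hp.2 (notMem_of_mem_bBaseSet Z hij hp.1 hp.2)

theorem contMDiffOn_bTransition_smul_id (Z : Finset Circle) (i j : Option Z) :
    ContMDiffOn (𝓡 1) 𝓘(ℝ, ℝ →L[ℝ] ℝ) ∞
      (fun p => bTransition Z i j p • ContinuousLinearMap.id ℝ ℝ)
      (bBaseSet Z i ∩ bBaseSet Z j) :=
  (contMDiffOn_bTransition Z i j).smul contMDiffOn_const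

open Classical in
/-- The gluing data of the `b`-tangent bundle of `(S¹, Z)`. -/
def bTangentCore (Z : Finset Circle) : VectorBundleCore ℝ Circle ℝ (Option Z) where
  baseSet := bBaseSet Z
  isOpen_baseSet := bBaseSet_isOpen Z
  indexAt p := if h : p ∈ Z then some ⟨p, h⟩ else none
  mem_baseSet_at p := by
    by_cases h : p ∈ Z
    · simp [h, bBaseSet]
    · simp [h, bBaseSet]
  coordChange i j p := bTransition Z i j p • ContinuousLinearMap.id ℝ ℝ
  coordChange_self i p _ v := by simp [bTransition]
  continuousOn_coordChange i j := (contMDiffOn_bTransition_smul_id Z i j).continuousOn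
  coordChange_comp i j k p hp v := by
    by_cases hij : i = j
    · subst hij
      simp [bTransition]
    by_cases hjk : j = k
    · subst hjk
      simp [bTransition]
    have hpZ := notMem_of_mem_bBaseSet Z hij hp.1.1 hp.1.2
    have hi := bDefFun_ne_zero Z i p hp.1.1 hpZ
    have hj := bDefFun_ne_zero Z j p hp.1.2 hpZ
    have hk := bDefFun_ne_zero Z k p hp.2 hpZ
    by_cases hik : i = k
    · subst hik
      simp [bTransition, hij, hjk]
      field_simp
    · simp [bTransition, hij, hjk, hik]
      field_simp

instance bTangentCore_isContMDiff (Z : Finset Circle) :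
    (bTangentCore Z).IsContMDiff (𝓡 1) ∞ where
  contMDiffOn_coordChange := contMDiffOn_bTransition_smul_id Z

/-- The fibres of the `b`-tangent bundle of `(S¹, Z)`; the topology of the total space and the
smooth vector bundle structure are those of `bTangentCore Z`. -/
abbrev BTangentSpace (Z : Finset Circle) : Circle → Type := (bTangentCore Z).Fiber

end CircleBundle

/-! ### Hadamard's lemma on the real line. -/

section Hadamard

open intervalIntegral MeasureTheory Topology

/-! The field `∂/∂θ` trivializes `TS¹`, so vector fields on the circle are functions and `b`-vector
fields are the smooth functions vanishing on `Z`. By Hadamard's lemma such a function is, near `z ∈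
Z`, a smooth multiple of `Im (p / z)`; this makes the glued bundle a `b`-tangent bundle.

The classification passes through global defining functions (`IsDefiningFunction`): smooth `G`
vanishing exactly on `Z`, to first order. If `E ≅ TS¹`, a global frame of `E` is sent by the anchor
to `G ∂/∂θ` with such a `G` (`exists_isDefiningFunction_of_isomorphic`). Conversely `G ∂/∂θ` lifts
to a section of `E`, which is a global frame because every `b`-vector field is divisible by it
(`IsDefiningFunction.isomorphic`).

It remains to see that `G` exists exactly for even `#Z`. For even `#Z`, pair the points and multiply
the equations of the chords. For odd `#Z`, the lift of `G` to `ℝ` times the product of the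
half-angle sines never changes sign, yet is antiperiodic (`IsDefiningFunction.even_card`). -/

theorem hasDerivAt_integral_pow_mul_comp_mul {φ : ℝ → ℝ} (hφ : ContDiff ℝ 1 φ) (k : ℕ) (x₀ : ℝ) :
    HasDerivAt (fun x => ∫ s in (0 : ℝ)..1, s ^ k * φ (s * x))
      (∫ s in (0 : ℝ)..1, s ^ (k + 1) * deriv φ (s * x₀)) x₀ := by
  have hc : Continuous φ := hφ.continuous
  have hc' : Continuous (deriv φ) := hφ.continuous_deriv le_rfl
  obtain ⟨C, hC⟩ := (isCompact_closedBall (0 : ℝ) (|x₀| + 1)).exists_bound_of_continuousOn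
    hc'.continuousOn
  refine (intervalIntegral.hasDerivAt_integral_of_dominated_loc_of_deriv_le (bound := fun _ => C)
    (F' := fun x s => s ^ (k + 1) * deriv φ (s * x))
    (Metric.ball_mem_nhds x₀ one_pos) (.of_forall fun x => ?_) ?_ ?_ (.of_forall ?_) ?_
    (.of_forall ?_)).2
  · exact Continuous.aestronglyMeasurable (by fun_prop)
  · exact Continuous.intervalIntegrable (by fun_prop) _ _
  · exact Continuous.aestronglyMeasurable (by fun_prop)
  · intro s hs x hx
    rw [uIoc_of_le zero_le_one] at hs
    have hx' : |x| ≤ |x₀| + 1 := by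
      rw [Metric.mem_ball, Real.dist_eq] at hx
      have := abs_add_le (x - x₀) x₀
      rw [sub_add_cancel] at this
      linarith
    have h1 : ‖deriv φ (s * x)‖ ≤ C := by
      apply hC
      rw [mem_closedBall_zero_iff, Real.norm_eq_abs, abs_mul, abs_of_pos hs.1]
      nlinarith [abs_nonneg x, hs.2]
    rw [norm_mul, norm_pow, Real.norm_of_nonneg hs.1.le]
    exact (mul_le_of_le_one_left (norm_nonneg _) (pow_le_one₀ hs.1.le hs.2)).trans h1
  · exact intervalIntegrable_const
  · intro s _ x _
    have h1 : HasDerivAt φ (deriv φ (s * x)) (s * x) :=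
      (hφ.differentiable one_ne_zero _).hasDerivAt
    have h2 : HasDerivAt (fun x => s * x) s x := by
      simpa using (hasDerivAt_id x).const_mul s
    exact ((h1.comp x h2).const_mul (s ^ k)).congr_deriv (by ring)

/-- The weight `s ^ k` is what closes the induction: differentiating under the integral replaces `φ`
by its derivative and raises `k` by one. -/
theorem contDiff_integral_pow_mul_comp_mul (n : ℕ) {φ : ℝ → ℝ} (hφ : ContDiff ℝ n φ) (k : ℕ) :
    ContDiff ℝ n (fun x => ∫ s in (0 : ℝ)..1, s ^ k * φ (s * x)) := by
  induction n generalizing φ k with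
  | zero =>
    have hc : Continuous φ := hφ.continuous
    exact contDiff_zero.2 (continuous_parametric_intervalIntegral_of_continuous' (by fun_prop) _ _)
  | succ n ih =>
    have h1 : ContDiff ℝ 1 φ := hφ.of_le (by exact_mod_cast Nat.le_add_left 1 n)
    have hd := hasDerivAt_integral_pow_mul_comp_mul h1 k
    push_cast at hφ ⊢
    rw [contDiff_succ_iff_deriv] at hφ ⊢
    refine ⟨fun x => (hd x).differentiableAt, by simp, ?_⟩
    rw [funext fun x => (hd x).deriv]
    exact ih hφ.2.2 (k + 1)

/-- Integrate the derivative of `s ↦ f (s * x)` over `[0, 1]`; the chain rule produces the factor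
`x`. -/
theorem exists_contDiff_eq_mul {f : ℝ → ℝ} (hf : ContDiff ℝ ∞ f) (h0 : f 0 = 0) :
    ∃ h : ℝ → ℝ, ContDiff ℝ ∞ h ∧ ∀ x, f x = x * h x := by
  refine ⟨fun x => ∫ s in (0 : ℝ)..1, s ^ 0 * deriv f (s * x), ?_, fun x => ?_⟩
  · rw [contDiff_infty]
    exact fun n => contDiff_integral_pow_mul_comp_mul n
      ((contDiff_infty_iff_deriv.1 hf).2.of_le (by exact_mod_cast le_top)) 0
  · have hc' : Continuous (deriv f) := hf.continuous_deriv (by simp)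
    have := integral_eq_sub_of_hasDerivAt (a := (0 : ℝ)) (b := 1) (f := fun s => f (s * x))
      (f' := fun s => x * deriv f (s * x)) (fun s _ => by
        have h1 : HasDerivAt f (deriv f (s * x)) (s * x) :=
          (hf.differentiable (by simp) _).hasDerivAt
        have h2 : HasDerivAt (fun s => s * x) x s := by
          simpa using (hasDerivAt_id s).mul_const x
        exact (h1.comp s h2).congr_deriv (mul_comm _ _))
      (Continuous.intervalIntegrable (by fun_prop) _ _)
    simpa [h0] using this.symm

theorem exists_contDiff_eventuallyEq_mul {f : ℝ → ℝ} {U : Set ℝ} (hU : U ∈ 𝓝 0)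
    (hf : ContDiffOn ℝ ∞ f U) (h0 : f 0 = 0) :
    ∃ h : ℝ → ℝ, ContDiff ℝ ∞ h ∧ ∀ᶠ x in 𝓝 0, f x = x * h x := by
  obtain ⟨r, hr, hrU⟩ := Metric.mem_nhds_iff.1 hU
  -- The support of `χ` is the closed ball of radius `r / 2`, inside the ball where `f` is smooth,
  -- so `χ * f` is smooth on all of `ℝ`.
  let χ : ContDiffBump (0 : ℝ) := ⟨r / 4, r / 2, by positivity, by linarith⟩
  have hχ : ContDiff ℝ ∞ (fun x => χ x * f x) := by
    refine contDiff_iff_contDiffAt.2 fun x => ?_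
    by_cases hx : x ∈ Metric.ball (0 : ℝ) r
    · exact χ.contDiff.contDiffAt.mul
        (hf.contDiffAt (Filter.mem_of_superset (Metric.isOpen_ball.mem_nhds hx) hrU))
    · have hx' : x ∉ tsupport χ := by
        rw [χ.tsupport_eq]
        intro h
        exact hx (Metric.closedBall_subset_ball (show r / 2 < r by linarith) h)
      refine (contDiffAt_const (c := (0 : ℝ))).congr_of_eventuallyEq ?_
      filter_upwards [notMem_tsupport_iff_eventuallyEq.1 hx'] with y hy
      simp [hy]
  obtain ⟨h, hh, heq⟩ := exists_contDiff_eq_mul hχ (by simp [h0])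
  refine ⟨h, hh, ?_⟩
  filter_upwards [χ.eventuallyEq_one] with x hx
  rw [← heq, hx]
  simp

end Hadamard

/-! ### Frames and coframes of line bundles. -/

section Sections

set_option linter.unusedSectionVars false

open Topology

variable {EM : Type*} [NormedAddCommGroup EM] [NormedSpace ℝ EM]
  {H : Type*} [TopologicalSpace H] (I : ModelWithCorners ℝ EM H)
  {M : Type*} [TopologicalSpace M] [ChartedSpace H M]
  (F : Type*) [NormedAddCommGroup F] [NormedSpace ℝ F]
  (E : M → Type*) [TopologicalSpace (TotalSpace F E)] [∀ p, AddCommGroup (E p)]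
  [∀ p, Module ℝ (E p)] [∀ p, TopologicalSpace (E p)] [FiberBundle F E] [VectorBundle ℝ F E]

theorem contMDiffOn_trivializationAt_symm [ContMDiffVectorBundle ∞ F E I] (p₀ : M) (v : F) :
    ContMDiffOn I (I.prod 𝓘(ℝ, F)) ∞
      (fun p => TotalSpace.mk' F p ((trivializationAt F E p₀).symm p v))
      (trivializationAt F E p₀).baseSet := by
  rw [(trivializationAt F E p₀).contMDiffOn_section_baseSet_iff]
  exact (contMDiffOn_const (c := v)).congr fun p hp => by rw [Trivialization.apply_mk_symm _ hp]

theorem exists_contMDiffOn_section [ContMDiffVectorBundle ∞ F E I] (p₀ : M) (w : E p₀) :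
    ∃ U : Set M, IsOpen U ∧ p₀ ∈ U ∧ ∃ s : ∀ p, E p, s p₀ = w ∧
      ContMDiffOn I (I.prod 𝓘(ℝ, F)) ∞ (fun p => TotalSpace.mk' F p (s p)) U :=
  ⟨_, (trivializationAt F E p₀).open_baseSet, mem_baseSet_trivializationAt F E p₀,
    fun p => (trivializationAt F E p₀).symm p (trivializationAt F E p₀ ⟨p₀, w⟩).2,
    Trivialization.symm_apply_apply_mk _ (mem_baseSet_trivializationAt F E p₀) w,
    contMDiffOn_trivializationAt_symm I F E p₀ _⟩

variable {I F E}
variable {X : ∀ p, E p} {θ : ∀ p, E p →ₗ[ℝ] ℝ}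

/-- For a smooth local section `s` through `X p₀`, `X = s / θ(s)` near `p₀`, since `θ(s)` is `1` at
`p₀`. -/
theorem contMDiff_frame_of_coframe [ContMDiffVectorBundle ∞ F E I]
    (hθ : ContMDiff (I.prod 𝓘(ℝ, F)) 𝓘(ℝ, ℝ) ∞ (fun v : TotalSpace F E => θ v.1 v.2))
    (hX : ∀ p, θ p (X p) = 1) (h : ∀ p w, θ p w • X p = w) :
    ContMDiff I (I.prod 𝓘(ℝ, F)) ∞ (fun p => TotalSpace.mk' F p (X p)) := by
  intro p₀
  obtain ⟨U, hU, hpU, s, hs₀, hsU⟩ := exists_contMDiffOn_section I F E p₀ (X p₀)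
  have hs := hsU.contMDiffAt (hU.mem_nhds hpU)
  have hc : ContMDiffAt I 𝓘(ℝ, ℝ) ∞ (fun p => θ p (s p)) p₀ := hθ.contMDiffAt.comp p₀ hs
  have hne : θ p₀ (s p₀) ≠ 0 := by simp [hs₀, hX]
  refine ((hc.inv₀ hne).smul_section hs).congr_of_eventuallyEq ?_
  filter_upwards [hc.continuousAt.eventually_ne hne] with p hp
  simp only [Pi.smul_apply', TotalSpace.mk_inj]
  calc X p = (θ p (s p))⁻¹ • (θ p (s p) • X p) := by
        rw [smul_smul, inv_mul_cancel₀ hp, one_smul]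
    _ = _ := by rw [h]

/-- In a trivialization `v = θ(v) X` is an equation in `F`. A functional `ℓ` nonzero on `X p₀` turns
it into `θ(v) = ℓ(v) / ℓ(X)`, with no need to identify `F` with `ℝ`. -/
theorem contMDiff_coframe_of_frame
    (hsm : ContMDiff I (I.prod 𝓘(ℝ, F)) ∞ (fun p => TotalSpace.mk' F p (X p)))
    (hX : ∀ p, θ p (X p) = 1) (h : ∀ p w, θ p w • X p = w) :
    ContMDiff (I.prod 𝓘(ℝ, F)) 𝓘(ℝ, ℝ) ∞ (fun v : TotalSpace F E => θ v.1 v.2) := by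
  intro v₀
  set p₀ := v₀.proj
  set e := trivializationAt F E p₀
  have hmem : p₀ ∈ e.baseSet := mem_baseSet_trivializationAt F E p₀
  have hσ : ContMDiffAt I 𝓘(ℝ, F) ∞ (fun p => (e ⟨p, X p⟩).2) p₀ :=
    (contMDiffAt_section p₀).1 (hsm p₀)
  have hv : ContMDiffAt (I.prod 𝓘(ℝ, F)) 𝓘(ℝ, F) ∞ (fun v : TotalSpace F E => (e v).2) v₀ :=
    (contMDiffAt_totalSpace.1 contMDiffAt_id).2
  have hσ₀ : (e ⟨p₀, X p₀⟩).2 ≠ 0 := by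
    intro h0
    have h1 : X p₀ = 0 := by
      have h2 := e.symm_apply_apply_mk hmem (X p₀)
      rw [h0] at h2
      rw [← h2, ← e.symmL_apply (R := ℝ) hmem, map_zero]
    have h3 := hX p₀
    rw [h1, map_zero] at h3
    exact zero_ne_one h3
  obtain ⟨ℓ, -, hℓ⟩ := exists_dual_vector ℝ _ (norm_ne_zero_iff.2 hσ₀)
  have hden : ContMDiffAt (I.prod 𝓘(ℝ, F)) 𝓘(ℝ, ℝ) ∞
      (fun v : TotalSpace F E => ℓ (e ⟨v.proj, X v.proj⟩).2) v₀ :=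
    ℓ.contDiff.contMDiff.contMDiffAt.comp v₀
      (ContMDiffAt.comp (g := fun p => (e ⟨p, X p⟩).2) v₀ hσ (contMDiffAt_proj E))
  have hnum : ContMDiffAt (I.prod 𝓘(ℝ, F)) 𝓘(ℝ, ℝ) ∞
      (fun v : TotalSpace F E => ℓ (e v).2) v₀ := ℓ.contDiff.contMDiff.contMDiffAt.comp v₀ hv
  have hne : ℓ (e ⟨v₀.proj, X v₀.proj⟩).2 ≠ 0 := by
    rw [hℓ]
    simpa using hσ₀
  refine (hnum.div₀ hden hne).congr_of_eventuallyEq ?_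
  filter_upwards [hden.continuousAt.eventually_ne hne,
    (FiberBundle.continuous_proj F E).continuousAt.preimage_mem_nhds
      (e.open_baseSet.mem_nhds hmem)] with v hv1 hv2
  have hlin : (e v).2 = θ v.1 v.2 • (e ⟨v.1, X v.1⟩).2 := by
    have : (e ⟨v.1, v.2⟩).2 = (e ⟨v.1, θ v.1 v.2 • X v.1⟩).2 := by rw [h]
    exact this.trans ((e.linear ℝ hv2).map_smul _ _)
  rw [Pi.div_apply, eq_div_iff hv1, hlin]
  simp

variable {F' : Type*} [NormedAddCommGroup F'] [NormedSpace ℝ F']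
  {E' : M → Type*} [TopologicalSpace (TotalSpace F' E')] [∀ p, AddCommGroup (E' p)]
  [∀ p, Module ℝ (E' p)] [∀ p, TopologicalSpace (E' p)] [FiberBundle F' E'] [VectorBundle ℝ F' E']
  {X' : ∀ p, E' p} {θ' : ∀ p, E' p →ₗ[ℝ] ℝ}

theorem contMDiff_coframe_smul_frame
    (hθ : ContMDiff (I.prod 𝓘(ℝ, F)) 𝓘(ℝ, ℝ) ∞ (fun v : TotalSpace F E => θ v.1 v.2))
    (hX' : ContMDiff I (I.prod 𝓘(ℝ, F')) ∞ (fun p => TotalSpace.mk' F' p (X' p))) :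
    ContMDiff (I.prod 𝓘(ℝ, F)) (I.prod 𝓘(ℝ, F')) ∞
      (fun v : TotalSpace F E => TotalSpace.mk' F' v.proj (θ v.proj v.snd • X' v.proj)) := by
  intro v₀
  refine contMDiffAt_totalSpace.2 ⟨contMDiffAt_proj E, ?_⟩
  have h1 : ContMDiffAt I 𝓘(ℝ, F') ∞
      (fun p => (trivializationAt F' E' v₀.proj ⟨p, X' p⟩).2) v₀.proj :=
    (contMDiffAt_section v₀.proj).1 (hX' v₀.proj)
  have h2 : ContMDiffAt (I.prod 𝓘(ℝ, F)) 𝓘(ℝ, F') ∞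
      (fun v : TotalSpace F E => (trivializationAt F' E' v₀.proj ⟨v.proj, X' v.proj⟩).2) v₀ :=
    ContMDiffAt.comp (g := fun p => (trivializationAt F' E' v₀.proj ⟨p, X' p⟩).2) v₀ h1
      (contMDiffAt_proj E)
  refine (hθ.contMDiffAt.smul h2).congr_of_eventuallyEq ?_
  filter_upwards [(FiberBundle.continuous_proj F E).continuousAt.preimage_mem_nhds
    ((trivializationAt F' E' v₀.proj).open_baseSet.mem_nhds
      (mem_baseSet_trivializationAt F' E' v₀.proj))] with v hv
  exact ((trivializationAt F' E' v₀.proj).linear ℝ hv).map_smul _ _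

theorem ContMDiffOn.comp_section {U : Set M} {s : ∀ p, E p}
    (hθ : ContMDiff (I.prod 𝓘(ℝ, F)) 𝓘(ℝ, ℝ) ∞ (fun v : TotalSpace F E => θ v.1 v.2))
    (hs : ContMDiffOn I (I.prod 𝓘(ℝ, F)) ∞ (fun p => TotalSpace.mk' F p (s p)) U) :
    ContMDiffOn I 𝓘(ℝ, ℝ) ∞ (fun p => θ p (s p)) U :=
  hθ.comp_contMDiffOn hs

theorem ContMDiffOn.map_section {U : Set M} {s : ∀ p, E p} {φ : ∀ p, E p → E' p}
    (hφ : ContMDiff (I.prod 𝓘(ℝ, F)) (I.prod 𝓘(ℝ, F')) ∞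
      (fun v : TotalSpace F E => TotalSpace.mk' F' v.proj (φ v.proj v.snd)))
    (hs : ContMDiffOn I (I.prod 𝓘(ℝ, F)) ∞ (fun p => TotalSpace.mk' F p (s p)) U) :
    ContMDiffOn I (I.prod 𝓘(ℝ, F')) ∞ (fun p => TotalSpace.mk' F' p (φ p (s p))) U :=
  hφ.comp_contMDiffOn hs

theorem smoothVectorBundleIsomorphic_of_frames
    (hsm : ContMDiff I (I.prod 𝓘(ℝ, F)) ∞ (fun p => TotalSpace.mk' F p (X p)))
    (hX : ∀ p, θ p (X p) = 1) (h : ∀ p w, θ p w • X p = w)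
    (hsm' : ContMDiff I (I.prod 𝓘(ℝ, F')) ∞ (fun p => TotalSpace.mk' F' p (X' p)))
    (hX' : ∀ p, θ' p (X' p) = 1) (h' : ∀ p w, θ' p w • X' p = w) :
    SmoothVectorBundleIsomorphic I F E F' E' :=
  ⟨fun p => LinearEquiv.ofLinearMap ((θ p).smulRight (X' p)) ((θ' p).smulRight (X p))
      (LinearMap.ext fun w => by simp [hX, h']) (LinearMap.ext fun w => by simp [hX', h]),
    contMDiff_coframe_smul_frame (contMDiff_coframe_of_frame hsm hX h) hsm',
    contMDiff_coframe_smul_frame (contMDiff_coframe_of_frame hsm' hX' h') hsm⟩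

end Sections

/-! ### The global frame `∂/∂θ` and coframe `dθ` of the circle. -/

section Frame

attribute [local instance] finrank_real_complex_fact'

/-- The differential of the inclusion of the circle into `ℂ`. -/
noncomputable def circleInclusionDeriv (p : Circle) : TangentSpace (𝓡 1) p →L[ℝ] ℂ :=
  mfderiv (𝓡 1) 𝓘(ℝ, ℂ) (fun q : Circle => (q : ℂ)) p

theorem contMDiff_circle_coe : ContMDiff (𝓡 1) 𝓘(ℝ, ℂ) ∞ (fun q : Circle => (q : ℂ)) :=
  contMDiff_coe_sphere

theorem hasMFDerivAt_circle_coe (p : Circle) :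
    HasMFDerivAt (𝓡 1) 𝓘(ℝ, ℂ) (fun q : Circle => (q : ℂ)) p (circleInclusionDeriv p) :=
  (contMDiff_circle_coe.mdifferentiable (by simp) p).hasMFDerivAt

theorem circleInclusionDeriv_injective (p : Circle) :
    Function.Injective (circleInclusionDeriv p) :=
  injective_mvfderiv_subtypeVal_sphere (E := ℂ) (n := 1) p

theorem range_circleInclusionDeriv (p : Circle) :
    LinearMap.range (circleInclusionDeriv p : TangentSpace (𝓡 1) p →ₗ[ℝ] ℂ) =
      (Submodule.span ℝ {(p : ℂ)})ᗮ :=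
  range_mvfderiv_subtypeVal (E := ℂ) (n := 1) p

theorem exists_circleInclusionDeriv_eq (p : Circle) :
    ∃ v, circleInclusionDeriv p v = p * Complex.I := by
  have : (p : ℂ) * Complex.I ∈ (Submodule.span ℝ {(p : ℂ)})ᗮ := by
    rw [Submodule.mem_orthogonal_singleton_iff_inner_right]
    simp [Complex.inner]
    ring
  rw [← range_circleInclusionDeriv] at this
  exact this

/-- The vector field `∂/∂θ` on the circle. -/
noncomputable def angularField (p : Circle) : TangentSpace (𝓡 1) p :=
  (exists_circleInclusionDeriv_eq p).choose

theorem circleInclusionDeriv_angularField (p : Circle) :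
    circleInclusionDeriv p (angularField p) = p * Complex.I :=
  (exists_circleInclusionDeriv_eq p).choose_spec

/-- The one-form `dθ` on the circle. -/
noncomputable def angularForm (p : Circle) : TangentSpace (𝓡 1) p →L[ℝ] ℝ :=
  Complex.imCLM ∘L (((p⁻¹ : Circle) : ℂ) • ContinuousLinearMap.id ℝ ℂ) ∘L circleInclusionDeriv p

theorem angularForm_apply (p : Circle) (w : TangentSpace (𝓡 1) p) :
    angularForm p w = (((p⁻¹ : Circle) : ℂ) * circleInclusionDeriv p w).im := rfl

@[simp]
theorem angularForm_angularField (p : Circle) : angularForm p (angularField p) = 1 := by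
  rw [angularForm_apply, circleInclusionDeriv_angularField, ← mul_assoc, ← Circle.coe_mul]
  simp

/-- The image of `w` in `ℂ` is orthogonal to `p`, hence a real multiple of `p * I`, and `dθ` reads
off the coefficient. -/
theorem angularForm_smul_angularField (p : Circle) (w : TangentSpace (𝓡 1) p) :
    angularForm p w • angularField p = w := by
  apply circleInclusionDeriv_injective
  have hw : circleInclusionDeriv p w ∈ (Submodule.span ℝ {(p : ℂ)})ᗮ := by
    rw [← range_circleInclusionDeriv]
    exact ⟨w, rfl⟩
  rw [Submodule.mem_orthogonal_singleton_iff_inner_right] at hw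
  rw [map_smul, circleInclusionDeriv_angularField, angularForm_apply]
  have hn := Circle.normSq_coe p
  rw [Complex.normSq_apply] at hn
  set u := circleInclusionDeriv p w
  simp [Complex.inner] at hw
  apply Complex.ext
  · simp
    linear_combination (-(p : ℂ).re) * hw + u.re * hn
  · simp
    linear_combination (-(p : ℂ).im) * hw + u.im * hn

theorem angularForm_eq_zero_iff {p : Circle} {w : TangentSpace (𝓡 1) p} :
    angularForm p w = 0 ↔ w = 0 :=
  ⟨fun h => by rw [← angularForm_smul_angularField p w, h, zero_smul], fun h => by simp [h]⟩

theorem contMDiff_angularForm :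
    ContMDiff (𝓡 1).tangent 𝓘(ℝ, ℝ) ∞
      (fun v : TangentBundle (𝓡 1) Circle => angularForm v.1 v.2) := by
  have h1 : ContMDiff (𝓡 1).tangent 𝓘(ℝ, ℂ) ∞
      (fun v : TangentBundle (𝓡 1) Circle => circleInclusionDeriv v.1 v.2) :=
    (contMDiff_snd_tangentBundle_modelSpace ℂ 𝓘(ℝ, ℂ)).comp
      (contMDiff_circle_coe.contMDiff_tangentMap (m := ∞) (by simp))
  have h2 : ContMDiff (𝓡 1).tangent 𝓘(ℝ, ℂ) ∞
      (fun v : TangentBundle (𝓡 1) Circle => ((v.1 : Circle) : ℂ)) :=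
    contMDiff_circle_coe.comp (contMDiff_proj _)
  have h3 : ContDiff ℝ ∞ (fun x : ℂ × ℂ => ((starRingEnd ℂ) x.1 * x.2).im) :=
    Complex.imCLM.contDiff.comp ((Complex.conjCLE.contDiff.comp contDiff_fst).mul contDiff_snd)
  have h4 := h3.contMDiff.comp (h2.prodMk_space h1)
  refine h4.congr fun v => ?_
  rw [angularForm_apply, Circle.coe_inv_eq_conj]
  rfl

/-- The field was chosen point by point, so its smoothness is not visible from its construction; it
is inherited from that of `dθ`. -/
theorem contMDiff_angularField :
    ContMDiff (𝓡 1) (𝓡 1).tangent ∞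
      (fun p : Circle => (⟨p, angularField p⟩ : TangentBundle (𝓡 1) Circle)) :=
  contMDiff_frame_of_coframe (θ := fun p => (angularForm p : TangentSpace (𝓡 1) p →ₗ[ℝ] ℝ))
    contMDiff_angularForm angularForm_angularField angularForm_smul_angularField

/-- Makes `Im (p / z)` the test function that detects whether a vector field vanishes at `z`. -/
theorem mfderiv_bDefFun_some (Z : Finset Circle) (z : Z) (w : TangentSpace (𝓡 1) z.1) :
    mfderiv (𝓡 1) 𝓘(ℝ, ℝ) (bDefFun Z (some z)) z.1 w = angularForm z.1 w := by
  have h := (Complex.imCLM ∘L (((z.1⁻¹ : Circle) : ℂ) •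
    ContinuousLinearMap.id ℝ ℂ)).hasMFDerivAt.comp z.1 (hasMFDerivAt_circle_coe z.1)
  have h5 : (Complex.imCLM ∘L (((z.1⁻¹ : Circle) : ℂ) •
      ContinuousLinearMap.id ℝ ℂ)) ∘ (fun q : Circle => (q : ℂ)) = bDefFun Z (some z) := by
    funext q
    simp [bDefFun, div_eq_inv_mul]
  rw [h5] at h
  rw [h.mfderiv]
  rfl

theorem ContMDiffOn.angularForm {U : Set Circle} {X : ∀ p : Circle, TangentSpace (𝓡 1) p}
    (hX : ContMDiffOn (𝓡 1) (𝓡 1).tangent ∞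
      (fun p => (⟨p, X p⟩ : TangentBundle (𝓡 1) Circle)) U) :
    ContMDiffOn (𝓡 1) 𝓘(ℝ, ℝ) ∞ (fun p => angularForm p (X p)) U :=
  ContMDiffOn.comp_section (θ := fun p => (_root_.angularForm p : TangentSpace (𝓡 1) p →ₗ[ℝ] ℝ))
    contMDiff_angularForm hX

theorem angularForm_smul (p : Circle) (c : ℝ) :
    angularForm p (c • angularField p) = c := by
  rw [map_smul, angularForm_angularField, smul_eq_mul, mul_one]

end Frame

/-! ### Global defining functions of finite sets, and parity. -/

section CircleFunctions

open Topology

attribute [local instance] finrank_real_complex_fact'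

theorem eventually_ne_bDefFun (Z : Finset Circle) (z : Z) :
    ∀ᶠ p in 𝓝 z.1, p ≠ z.1 → p ∉ Z ∧ bDefFun Z (some z) p ≠ 0 := by
  filter_upwards [(bBaseSet_isOpen Z (some z)).mem_nhds ⟨by simp, by simp⟩] with p hp hne
  have hpZ : p ∉ Z := fun h => hp.2 ⟨h, hne⟩
  exact ⟨hpZ, bDefFun_ne_zero Z _ p hp hpZ⟩

/-- The local inverse at `z` of the function `p ↦ Im (p / z)`. -/
noncomputable def circleOfIm (z : Circle) (y : ℝ) : Circle :=
  z * Circle.exp (Real.arcsin y)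

theorem contMDiffOn_circleOfIm (z : Circle) :
    ContMDiffOn 𝓘(ℝ, ℝ) (𝓡 1) ∞ (circleOfIm z) (Ioo (-1) 1) := by
  have h1 : ContMDiffOn 𝓘(ℝ, ℝ) 𝓘(ℝ, ℝ) ∞ Real.arcsin (Ioo (-1) 1) := fun y hy =>
    (Real.contDiffAt_arcsin hy.1.ne' hy.2.ne).contMDiffAt.contMDiffWithinAt
  exact ((contMDiff_mul_left (I := 𝓡 1) (n := ∞) (a := z)).comp
    contMDiff_circleExp).comp_contMDiffOn h1

theorem circleOfIm_im (z p : Circle) (hp : 0 < ((p / z : Circle) : ℂ).re) :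
    circleOfIm z ((p / z : Circle) : ℂ).im = p := by
  have h := Complex.arg_of_re_nonneg hp.le
  rw [Circle.norm_coe, div_one] at h
  rw [circleOfIm, ← h, Circle.exp_arg, mul_div_cancel]

theorem continuous_im_div (z : Circle) :
    Continuous fun p : Circle => ((p / z : Circle) : ℂ).im := by
  simp only [Circle.coe_div]
  fun_prop

/-- Hadamard's lemma in the coordinate `Im (p / z)`, with local inverse `circleOfIm z`. -/
theorem exists_eq_mul_im_div (z : Circle) {U : Set Circle} (hU : U ∈ 𝓝 z)
    {g : Circle → ℝ} (hg : ContMDiffOn (𝓡 1) 𝓘(ℝ, ℝ) ∞ g U) (h0 : g z = 0) :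
    ∃ k : Circle → ℝ, ContMDiff (𝓡 1) 𝓘(ℝ, ℝ) ∞ k ∧
      ∀ᶠ p in 𝓝 z, g p = k p * ((p / z : Circle) : ℂ).im := by
  have hz : circleOfIm z 0 = z := by simp [circleOfIm]
  have hc : ContinuousAt (circleOfIm z) 0 :=
    (contMDiffOn_circleOfIm z).continuousOn.continuousAt (Ioo_mem_nhds (by simp) (by simp))
  have hV : Ioo (-1) 1 ∩ circleOfIm z ⁻¹' U ∈ 𝓝 (0 : ℝ) :=
    Filter.inter_mem (Ioo_mem_nhds (by simp) (by simp)) (hc.preimage_mem_nhds (by rwa [hz]))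
  have hgc : ContDiffOn ℝ ∞ (g ∘ circleOfIm z) (Ioo (-1) 1 ∩ circleOfIm z ⁻¹' U) :=
    (hg.comp ((contMDiffOn_circleOfIm z).mono inter_subset_left) fun y hy => hy.2).contDiffOn
  obtain ⟨h, hh, heq⟩ := exists_contDiff_eventuallyEq_mul hV hgc (by simp [hz, h0])
  refine ⟨h ∘ fun p => ((p / z : Circle) : ℂ).im,
    hh.contMDiff.comp (contMDiff_bDefFun {z} (some ⟨z, by simp⟩)), ?_⟩
  have hcf : Filter.Tendsto (fun p : Circle => ((p / z : Circle) : ℂ).im) (𝓝 z) (𝓝 0) := by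
    simpa using (continuous_im_div z).tendsto z
  have hre : ∀ᶠ p : Circle in 𝓝 z, 0 < ((p / z : Circle) : ℂ).re := by
    have : Continuous fun p : Circle => ((p / z : Circle) : ℂ).re := by
      simp only [Circle.coe_div]
      fun_prop
    exact this.continuousAt.eventually_const_lt (by simp)
  filter_upwards [hcf.eventually heq, hre] with p hp hpz
  rw [Function.comp_apply, circleOfIm_im z p hpz] at hp
  rw [hp, mul_comm]
  rfl

/-- `G` is a global defining function of the finite set `Z`: it is smooth and it vanishes exactly
on `Z`, to first order at every point. -/
structure IsDefiningFunction (Z : Finset Circle) (G : Circle → ℝ) : Prop where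
  contMDiff : ContMDiff (𝓡 1) 𝓘(ℝ, ℝ) ∞ G
  ne_zero : ∀ p ∉ Z, G p ≠ 0
  simple : ∀ z ∈ Z, ∃ k : Circle → ℝ, ContMDiffAt (𝓡 1) 𝓘(ℝ, ℝ) ∞ k z ∧ k z ≠ 0 ∧
    ∀ᶠ p in 𝓝 z, G p = k p * ((p / z : Circle) : ℂ).im

theorem IsDefiningFunction.eq_zero {Z : Finset Circle} {G : Circle → ℝ}
    (hG : IsDefiningFunction Z G) {z : Circle} (hz : z ∈ Z) : G z = 0 := by
  obtain ⟨k, -, -, h⟩ := hG.simple z hz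
  simpa using h.self_of_nhds

theorem IsDefiningFunction.exists_eq_mul {Z : Finset Circle} {G : Circle → ℝ}
    (hG : IsDefiningFunction Z G) {U : Set Circle} (hU : IsOpen U) {g : Circle → ℝ}
    (hg : ContMDiffOn (𝓡 1) 𝓘(ℝ, ℝ) ∞ g U) (h0 : ∀ z ∈ Z, z ∈ U → g z = 0) :
    ∃ h : Circle → ℝ, ContMDiffOn (𝓡 1) 𝓘(ℝ, ℝ) ∞ h U ∧ ∀ p ∈ U, g p = h p * G p := by
  classical
  have key : ∀ z ∈ Z, z ∈ U → ∃ k : Circle → ℝ, ContMDiffAt (𝓡 1) 𝓘(ℝ, ℝ) ∞ k z ∧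
      ∀ᶠ p in 𝓝 z, g p = k p * G p := by
    intro z hz hzU
    obtain ⟨k, hk, hgk⟩ := exists_eq_mul_im_div z (hU.mem_nhds hzU) hg (h0 z hz hzU)
    obtain ⟨l, hl, hl0, hGl⟩ := hG.simple z hz
    refine ⟨fun p => k p / l p, hk.contMDiffAt.div₀ hl hl0, ?_⟩
    filter_upwards [hgk, hGl, hl.continuousAt.eventually_ne hl0] with p h1 h2 h3
    rw [h1, h2]
    field_simp
  choose! k hk hgk using key
  -- At a point of `Z` the value comes from the local quotient centred at that point; elsewhere
  -- division by `G` is legitimate.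
  refine ⟨fun p => if p ∈ Z then k p p else g p / G p, fun p hp => ?_, fun p hp => ?_⟩
  · by_cases hpZ : p ∈ Z
    · refine ((hk p hpZ hp).congr_of_eventuallyEq ?_).contMDiffWithinAt
      filter_upwards [hgk p hpZ hp, eventually_ne_bDefFun Z ⟨p, hpZ⟩] with q hq hqZ
      by_cases hqp : q = p
      · simp [hqp, hpZ]
      · have hqZ' := (hqZ hqp).1
        have := hG.ne_zero q hqZ'
        simp [hqZ', hq, this]
    · have h1 := ((hg p hp).contMDiffAt (hU.mem_nhds hp)).div₀ hG.contMDiff.contMDiffAt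
        (hG.ne_zero p hpZ)
      refine (h1.congr_of_eventuallyEq ?_).contMDiffWithinAt
      filter_upwards [(bBaseSet_isOpen Z none).mem_nhds hpZ] with q hq
      have : q ∉ Z := hq
      simp [this]
  · by_cases hpZ : p ∈ Z
    · simp [hG.eq_zero hpZ, h0 p hpZ hp]
    · simp [hpZ, hG.ne_zero p hpZ]

/-- The affine function vanishing at the points `a` and `b`. -/
noncomputable def chordFun (a b p : Circle) : ℝ :=
  (((p : ℂ) - a) * (starRingEnd ℂ) ((b : ℂ) - a)).im

theorem contMDiff_chordFun (a b : Circle) : ContMDiff (𝓡 1) 𝓘(ℝ, ℝ) ∞ (chordFun a b) := by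
  have h : ContDiff ℝ ∞ (fun w : ℂ => ((w - a) * (starRingEnd ℂ) ((b : ℂ) - a)).im) :=
    Complex.imCLM.contDiff.comp ((contDiff_id.sub contDiff_const).mul contDiff_const)
  exact h.contMDiff.comp contMDiff_circle_coe

theorem chordFun_comm (a b p : Circle) : chordFun a b p = -chordFun b a p := by
  simp [chordFun]
  ring

theorem chordFun_eq (a b p : Circle) :
    chordFun a b p = ((p / a : Circle) : ℂ).im * (((b / a : Circle) : ℂ).re - 1) -
      ((b / a : Circle) : ℂ).im * (((p / a : Circle) : ℂ).re - 1) := by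
  have h : ∀ q : Circle, (q : ℂ) = a * ((q / a : Circle) : ℂ) := fun q => by
    rw [← Circle.coe_mul, mul_div_cancel]
  have hn := Circle.normSq_coe a
  rw [Complex.normSq_apply] at hn
  rw [chordFun, h p, h b]
  generalize ((p / a : Circle) : ℂ) = u
  generalize ((b / a : Circle) : ℂ) = v
  simp
  linear_combination (u.im * (v.re - 1) - v.im * (u.re - 1)) * hn

theorem Circle.re_ne_one {u : Circle} (hu : u ≠ 1) : (u : ℂ).re ≠ 1 := by
  intro h
  apply hu
  have hn := Circle.normSq_coe u
  rw [Complex.normSq_apply, h] at hn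
  exact Circle.ext (Complex.ext (by simpa using h) (by simpa using hn))

/-- A line meets the circle in at most two points. -/
theorem chordFun_ne_zero {a b p : Circle} (hab : a ≠ b) (ha : p ≠ a) (hb : p ≠ b) :
    chordFun a b p ≠ 0 := by
  intro h
  rw [chordFun_eq] at h
  have hu := Circle.re_ne_one (u := p / a) (by rwa [Ne, div_eq_one])
  have hv := Circle.re_ne_one (u := b / a) (by rwa [Ne, div_eq_one, eq_comm])
  have hnu := Circle.normSq_coe (p / a)
  have hnv := Circle.normSq_coe (b / a)
  rw [Complex.normSq_apply] at hnu hnv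
  apply hb
  rw [← div_left_inj (a := a)]
  apply Circle.ext
  generalize ((p / a : Circle) : ℂ) = u at *
  generalize ((b / a : Circle) : ℂ) = v at *
  -- Eliminate the imaginary parts: multiply `h` by the conjugate sum and use `im² = 1 - re²`.
  have h1 : (u.re - 1) * (v.re - 1) * (u.re - v.re) = 0 := by
    linear_combination (1 / 2) * (u.im * (v.re - 1) + v.im * (u.re - 1)) * h -
      (1 / 2) * (v.re - 1) ^ 2 * hnu + (1 / 2) * (u.re - 1) ^ 2 * hnv
  have h2 : u.re = v.re := by
    have := sub_ne_zero.2 hu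
    have := sub_ne_zero.2 hv
    simp_all [sub_eq_zero]
  have h3 : (u.im - v.im) * (v.re - 1) = 0 := by
    rw [h2] at h
    linear_combination h
  exact Complex.ext h2 (sub_eq_zero.1 ((mul_eq_zero.1 h3).resolve_right (sub_ne_zero.2 hv)))

theorem exists_chordFun_eq_mul {a b : Circle} (hab : a ≠ b) :
    ∃ k : Circle → ℝ, ContMDiffAt (𝓡 1) 𝓘(ℝ, ℝ) ∞ k a ∧ k a ≠ 0 ∧
      ∀ᶠ p in 𝓝 a, chordFun a b p = k p * ((p / a : Circle) : ℂ).im := by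
  have hv := Circle.re_ne_one (u := b / a) (by rwa [Ne, div_eq_one, eq_comm])
  have him : ContMDiff (𝓡 1) 𝓘(ℝ, ℝ) ∞ (fun p : Circle => ((p / a : Circle) : ℂ).im) :=
    contMDiff_bDefFun {a} (some ⟨a, by simp⟩)
  have hre : ContMDiff (𝓡 1) 𝓘(ℝ, ℝ) ∞ (fun p : Circle => 1 + ((p / a : Circle) : ℂ).re) := by
    have h : ContDiff ℝ ∞ (fun w : ℂ => 1 + (w / (a : ℂ)).re) :=
      contDiff_const.add (Complex.reCLM.contDiff.comp (contDiff_id.div_const _))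
    refine (h.contMDiff.comp contMDiff_circle_coe).congr fun p => ?_
    simp
  -- For `u = p / a` on the unit circle, `re u - 1 = -(im u)² / (1 + re u)`, so `im u` factors out
  -- of `chordFun_eq`.
  refine ⟨fun p => (((b / a : Circle) : ℂ).re - 1) + ((b / a : Circle) : ℂ).im *
    (((p / a : Circle) : ℂ).im / (1 + ((p / a : Circle) : ℂ).re)), ?_, ?_, ?_⟩
  · exact contMDiffAt_const.add (contMDiffAt_const.mul
      (him.contMDiffAt.div₀ hre.contMDiffAt (by norm_num)))
  · simpa using sub_ne_zero.2 hv
  · filter_upwards [hre.continuous.continuousAt.eventually_ne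
      (show 1 + ((a / a : Circle) : ℂ).re ≠ 0 by norm_num)] with p hp
    rw [chordFun_eq]
    have hnu := Circle.normSq_coe (p / a)
    rw [Complex.normSq_apply] at hnu
    field_simp
    linear_combination -(((b / a : Circle) : ℂ).im) * hnu

/-- Remove two points `a`, `b` at a time: `chordFun a b` vanishes simply at both and nowhere else on
the circle. -/
theorem exists_isDefiningFunction (n : ℕ) (Z : Finset Circle) (hZ : Z.card = n + n) :
    ∃ G, IsDefiningFunction Z G := by
  classical
  induction n generalizing Z with
  | zero =>
    obtain rfl : Z = ∅ := Finset.card_eq_zero.1 hZ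
    exact ⟨fun _ => 1, contMDiff_const, by simp, by simp⟩
  | succ n ih =>
    obtain ⟨a, ha⟩ : Z.Nonempty := Finset.card_pos.1 (by omega)
    obtain ⟨b, hb⟩ : (Z.erase a).Nonempty :=
      Finset.card_pos.1 (by rw [Finset.card_erase_of_mem ha]; omega)
    obtain ⟨G, hG⟩ := ih ((Z.erase a).erase b) (by
      rw [Finset.card_erase_of_mem hb, Finset.card_erase_of_mem ha]
      omega)
    have hba : b ≠ a := Finset.ne_of_mem_erase hb
    refine ⟨fun p => chordFun a b p * G p, (contMDiff_chordFun a b).mul hG.contMDiff,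
      fun p hp => ?_, fun z hz => ?_⟩
    · refine mul_ne_zero (chordFun_ne_zero hba.symm ?_ ?_) (hG.ne_zero p ?_)
      · rintro rfl
        exact hp ha
      · rintro rfl
        exact hp (Finset.mem_of_mem_erase hb)
      · exact fun h => hp (Finset.mem_of_mem_erase (Finset.mem_of_mem_erase h))
    · by_cases hza : z = a
      · subst hza
        obtain ⟨k, hk, hk0, hek⟩ := exists_chordFun_eq_mul hba.symm
        refine ⟨fun p => k p * G p, hk.mul hG.contMDiff.contMDiffAt,
          mul_ne_zero hk0 (hG.ne_zero _ (by simp)), ?_⟩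
        filter_upwards [hek] with p hp
        rw [hp]
        ring
      by_cases hzb : z = b
      · subst hzb
        obtain ⟨k, hk, hk0, hek⟩ := exists_chordFun_eq_mul hba
        refine ⟨fun p => -(k p * G p), (hk.mul hG.contMDiff.contMDiffAt).neg,
          neg_ne_zero.2 (mul_ne_zero hk0 (hG.ne_zero _ (by simp))), ?_⟩
        filter_upwards [hek] with p hp
        rw [chordFun_comm, hp]
        ring
      · obtain ⟨k, hk, hk0, hek⟩ := hG.simple z (by simp [hza, hzb, hz])
        refine ⟨fun p => chordFun a b p * k p, (contMDiff_chordFun a b).contMDiffAt.mul hk,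
          mul_ne_zero (chordFun_ne_zero hba.symm hza hzb) hk0, ?_⟩
        filter_upwards [hek] with p hp
        rw [hp]
        ring

/-- The points where `f` is locally nonnegative and those where it is locally nonpositive form two
open sets, disjoint by density of `f ≠ 0`; `ℝ` is connected. -/
theorem nonneg_or_nonpos_of_locally {f : ℝ → ℝ} (hd : Dense {x | f x ≠ 0})
    (h : ∀ x, (∀ᶠ y in 𝓝 x, 0 ≤ f y) ∨ ∀ᶠ y in 𝓝 x, f y ≤ 0) :
    (∀ x, 0 ≤ f x) ∨ ∀ x, f x ≤ 0 := by
  have hA : IsOpen {x | ∀ᶠ y in 𝓝 x, 0 ≤ f y} := isOpen_setOfPred_eventually_nhds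
  have hB : IsOpen {x | ∀ᶠ y in 𝓝 x, f y ≤ 0} := isOpen_setOfPred_eventually_nhds
  have hAB : {x | ∀ᶠ y in 𝓝 x, 0 ≤ f y}ᶜ = {x | ∀ᶠ y in 𝓝 x, f y ≤ 0} := by
    ext x
    refine ⟨fun hx => (h x).resolve_left hx, fun hx hx' => ?_⟩
    obtain ⟨y, hy, hy'⟩ := hd.inter_nhds_nonempty (Filter.inter_mem hx hx')
    exact hy (le_antisymm hy'.1 hy'.2)
  rcases isClopen_iff.1 (⟨⟨hAB ▸ hB⟩, hA⟩ : IsClopen {x | ∀ᶠ y in 𝓝 x, 0 ≤ f y}) with h0 | h0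
  · right
    intro x
    rw [h0, compl_empty] at hAB
    exact (hAB ▸ mem_univ x : x ∈ {x | ∀ᶠ y in 𝓝 x, f y ≤ 0}).self_of_nhds
  · left
    intro x
    exact (h0 ▸ mem_univ x : x ∈ {x | ∀ᶠ y in 𝓝 x, 0 ≤ f y}).self_of_nhds

theorem Circle.im_exp_div (θ : ℝ) (z : Circle) :
    ((Circle.exp θ / z : Circle) : ℂ).im = Real.sin (θ - Complex.arg z) := by
  conv_lhs => rw [← Circle.exp_arg z, ← Circle.exp_sub, Circle.coe_exp, Complex.exp_ofReal_mul_I_im]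

theorem Circle.sin_half_ne_zero {θ : ℝ} {z : Circle} (h : Circle.exp θ ≠ z) :
    Real.sin ((θ - Complex.arg z) / 2) ≠ 0 := by
  intro h0
  rw [Real.sin_eq_zero_iff] at h0
  obtain ⟨m, hm⟩ := h0
  apply h
  rw [← Circle.exp_arg z, Circle.exp_eq_exp]
  exact ⟨m, by linear_combination -2 * hm⟩

theorem Circle.cos_half_ne_zero (θ : ℝ) :
    Real.cos ((θ - Complex.arg (Circle.exp θ)) / 2) ≠ 0 := by
  obtain ⟨m, hm⟩ := Circle.exp_eq_exp.1 (Circle.exp_arg (Circle.exp θ)).symm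
  have : (θ - Complex.arg (Circle.exp θ)) / 2 = m * Real.pi := by
    linear_combination hm / 2
  rw [this]
  intro h
  have := Real.sin_sq_add_cos_sq (m * Real.pi)
  rw [h, Real.sin_int_mul_pi] at this
  norm_num at this

theorem Circle.dense_exp_notMem (Z : Finset Circle) : Dense {θ : ℝ | Circle.exp θ ∉ Z} := by
  have : (⋃ z ∈ Z, Set.range fun m : ℤ => Complex.arg z + m * (2 * Real.pi)).Countable :=
    Z.countable_toSet.biUnion fun _ _ => countable_range _
  refine Dense.mono ?_ (this.dense_compl ℝ)
  intro θ hθ hZ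
  apply hθ
  obtain ⟨m, hm⟩ := Circle.exp_eq_exp.1 (Circle.exp_arg (Circle.exp θ)).symm
  exact mem_biUnion hZ ⟨m, hm.symm⟩

/-- Each factor of `P` changes sign under `θ ↦ θ + 2π`, so for odd `#Z` the product of `P` with the
periodic lift of `G` is antiperiodic. But `P` and the lift of `G` both have simple zeros over `Z`,
so their product has double zeros and keeps a constant sign. -/
theorem IsDefiningFunction.even_card {Z : Finset Circle} {G : Circle → ℝ}
    (hG : IsDefiningFunction Z G) : Even Z.card := by
  classical
  by_contra hodd
  rw [Nat.not_even_iff_odd] at hodd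
  set P : ℝ → ℝ := fun θ => ∏ z ∈ Z, Real.sin ((θ - Complex.arg z) / 2) with hP
  have hGc : Continuous fun θ => G (Circle.exp θ) :=
    hG.contMDiff.continuous.comp Circle.exp.continuous
  have hPc : Continuous P := by fun_prop
  have hne : ∀ θ, Circle.exp θ ∉ Z → G (Circle.exp θ) * P θ ≠ 0 := fun θ hθ =>
    mul_ne_zero (hG.ne_zero _ hθ) (Finset.prod_ne_zero_iff.2 fun z hz =>
      Circle.sin_half_ne_zero fun h => hθ (h ▸ hz))
  have hsign : ∀ c : ℝ → ℝ, ∀ θ, ContinuousAt c θ → c θ ≠ 0 →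
      (∀ᶠ y in 𝓝 θ, 0 ≤ c y) ∨ ∀ᶠ y in 𝓝 θ, c y ≤ 0 := by
    intro c θ hc h0
    rcases h0.lt_or_gt with h | h
    · exact .inr ((hc.eventually_lt_const h).mono fun _ => le_of_lt)
    · exact .inl ((hc.eventually_const_lt h).mono fun _ => le_of_lt)
  have hanti : ∀ θ, G (Circle.exp (θ + 2 * Real.pi)) * P (θ + 2 * Real.pi) =
      -(G (Circle.exp θ) * P θ) := by
    intro θ
    have : P (θ + 2 * Real.pi) = -P θ := by
      rw [hP]
      have : ∀ z : Circle, Real.sin ((θ + 2 * Real.pi - Complex.arg z) / 2) =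
          -1 * Real.sin ((θ - Complex.arg z) / 2) := fun z => by
        rw [show (θ + 2 * Real.pi - Complex.arg z) / 2 = (θ - Complex.arg z) / 2 + Real.pi by ring,
          Real.sin_add_pi, neg_one_mul]
      simp only [this, Finset.prod_mul_distrib, Finset.prod_const, hodd.neg_one_pow]
      ring
    rw [this, Circle.periodic_exp]
    ring
  have hloc : ∀ θ, (∀ᶠ t in 𝓝 θ, 0 ≤ G (Circle.exp t) * P t) ∨
      ∀ᶠ t in 𝓝 θ, G (Circle.exp t) * P t ≤ 0 := by
    intro θ
    by_cases hZ : Circle.exp θ ∈ Z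
    · set z := Circle.exp θ with hz
      obtain ⟨k, hk, hk0, hek⟩ := hG.simple z hZ
      -- The half-angle formula splits `Im (exp t / z)` into `2 sin cos`; its sine pairs with the
      -- factor of `P` at `z` to form a square, and `c` is the nonvanishing rest.
      set c : ℝ → ℝ := fun t => k (Circle.exp t) * (2 * Real.cos ((t - Complex.arg z) / 2)) *
        ∏ w ∈ Z.erase z, Real.sin ((t - Complex.arg w) / 2) with hc
      have hkc : ContinuousAt (fun t => k (Circle.exp t)) θ :=
        ContinuousAt.comp (g := k) (hz ▸ hk.continuousAt) Circle.exp.continuous.continuousAt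
      have hcc : ContinuousAt c θ := (hkc.mul (by fun_prop)).mul (by fun_prop)
      have hc0 : c θ ≠ 0 := by
        refine mul_ne_zero (mul_ne_zero (hz ▸ hk0) (mul_ne_zero two_ne_zero
          (Circle.cos_half_ne_zero θ))) (Finset.prod_ne_zero_iff.2 fun w hw => ?_)
        exact Circle.sin_half_ne_zero (Finset.ne_of_mem_erase hw).symm
      have hev : ∀ᶠ t in 𝓝 θ, G (Circle.exp t) * P t =
          c t * Real.sin ((t - Complex.arg z) / 2) ^ 2 := by
        filter_upwards [Circle.exp.continuous.continuousAt.eventually hek] with t ht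
        have hPz : P t = Real.sin ((t - Complex.arg z) / 2) *
          ∏ w ∈ Z.erase z, Real.sin ((t - Complex.arg w) / 2) := (Finset.mul_prod_erase Z _ hZ).symm
        have h2 : Real.sin (t - Complex.arg z) = 2 * Real.sin ((t - Complex.arg z) / 2) *
            Real.cos ((t - Complex.arg z) / 2) := by
          rw [← Real.sin_two_mul]
          ring_nf
        rw [ht, hPz, hc, Circle.im_exp_div, h2]
        ring
      rcases hsign c θ hcc hc0 with h | h
      · left
        filter_upwards [h, hev] with t h3 h4
        rw [h4]
        positivity
      · right
        filter_upwards [h, hev] with t h3 h4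
        rw [h4]
        exact mul_nonpos_of_nonpos_of_nonneg h3 (sq_nonneg _)
    · exact hsign _ θ (hGc.mul hPc).continuousAt (hne θ hZ)
  obtain ⟨θ, hθ⟩ := (Circle.dense_exp_notMem Z).nonempty
  have h1 := hne θ hθ
  have h2 := hanti θ
  rcases nonneg_or_nonpos_of_locally ((Circle.dense_exp_notMem Z).mono hne) hloc with h | h
  · have := h θ
    have := h (θ + 2 * Real.pi)
    exact h1 (by linarith)
  · have := h θ
    have := h (θ + 2 * Real.pi)
    exact h1 (by linarith)

end CircleFunctions

/-! ### `b`-vector fields as functions vanishing on `Z`. -/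

section BVectorFields

open Topology

/-- Tangency is tested on `Im (p / z)` over a neighbourhood free of the other points of `Z`, where
this function does vanish on `Z`. -/
theorem isBVectorField_iff {Z : Finset Circle} {U : Set Circle} (hU : IsOpen U)
    {X : ∀ p : Circle, TangentSpace (𝓡 1) p} :
    IsBVectorField (𝓡 1) (Z : Set Circle) U X ↔
      ContMDiffOn (𝓡 1) 𝓘(ℝ, ℝ) ∞ (fun p => angularForm p (X p)) U ∧
        ∀ z ∈ Z, z ∈ U → angularForm z (X z) = 0 := by
  constructor
  · rintro ⟨hX, ht⟩
    refine ⟨hX.angularForm, fun z hz hzU => ?_⟩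
    rw [← mfderiv_bDefFun_some Z ⟨z, hz⟩ (X z)]
    have hz' := hU.inter (bBaseSet_isOpen Z (some ⟨z, hz⟩))
    refine ht (U ∩ bBaseSet Z (some ⟨z, hz⟩)) hz' inter_subset_left _
      (contMDiff_bDefFun Z _).contMDiffOn ?_ z ⟨hz, hzU, by simp [bBaseSet]⟩
    rintro p ⟨hpZ, -, hp⟩
    have : p = z := by
      by_contra h
      exact hp.2 ⟨hpZ, h⟩
    simp [bDefFun, this]
  · rintro ⟨hX, h0⟩
    refine ⟨(hX.smul_section contMDiff_angularField.contMDiffOn).congr fun p _ => ?_,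
      fun V _ hVU f _ _ p hp => ?_⟩
    · rw [Pi.smul_apply', angularForm_smul_angularField]
    · rw [angularForm_eq_zero_iff.1 (h0 p hp.1 (hVU hp.2))]
      exact map_zero _

theorem isBVectorField_smul_angularField {Z : Finset Circle} {U : Set Circle} (hU : IsOpen U)
    {g : Circle → ℝ} (hg : ContMDiffOn (𝓡 1) 𝓘(ℝ, ℝ) ∞ g U) (h0 : ∀ z ∈ Z, z ∈ U → g z = 0) :
    IsBVectorField (𝓡 1) (Z : Set Circle) U fun p => g p • angularField p := by
  rw [isBVectorField_iff hU]
  simpa using ⟨hg, h0⟩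

end BVectorFields

/-! ### The glued bundle is a `b`-tangent bundle. -/

section BTangent

open Topology

theorem bTangentCore_indexAt_of_mem (Z : Finset Circle) {p : Circle} (hp : p ∈ Z) :
    (bTangentCore Z).indexAt p = some ⟨p, hp⟩ := by
  simp [bTangentCore, hp]

theorem bTangentCore_indexAt_of_notMem (Z : Finset Circle) {p : Circle} (hp : p ∉ Z) :
    (bTangentCore Z).indexAt p = none := by
  simp [bTangentCore, hp]

/-- The coordinate on the fibre of the `b`-tangent bundle at `p` in its preferred frame. -/
noncomputable def bFiberEquiv (Z : Finset Circle) (p : Circle) : BTangentSpace Z p ≃ₗ[ℝ] ℝ :=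
  LinearEquiv.refl ℝ ℝ

theorem trivializationAt_bTangentSpace (Z : Finset Circle) (p q : Circle)
    (a : BTangentSpace Z q) :
    (trivializationAt ℝ (BTangentSpace Z) p ⟨q, a⟩).2 =
      bTransition Z ((bTangentCore Z).indexAt q) ((bTangentCore Z).indexAt p) q * bFiberEquiv Z q a :=
  rfl

/-- The pairing of `dθ` with the vectors of the `b`-tangent bundle. -/
noncomputable def bAngularForm (Z : Finset Circle) (p : Circle) : BTangentSpace Z p →ₗ[ℝ] ℝ :=
  bDefFun Z ((bTangentCore Z).indexAt p) p • (bFiberEquiv Z p).toLinearMap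

theorem bAngularForm_apply (Z : Finset Circle) (p : Circle) (a : BTangentSpace Z p) :
    bAngularForm Z p a = bDefFun Z ((bTangentCore Z).indexAt p) p * bFiberEquiv Z p a := rfl

theorem bAngularForm_of_mem {Z : Finset Circle} {p : Circle} (hp : p ∈ Z)
    (a : BTangentSpace Z p) : bAngularForm Z p a = 0 := by
  rw [bAngularForm_apply, bTangentCore_indexAt_of_mem Z hp]
  simp [bDefFun]

theorem bAngularForm_of_notMem {Z : Finset Circle} {p : Circle} (hp : p ∉ Z)
    (a : BTangentSpace Z p) : bAngularForm Z p a = bFiberEquiv Z p a := by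
  rw [bAngularForm_apply, bTangentCore_indexAt_of_notMem Z hp]
  simp [bDefFun]

/-- The product of `f i` with the coordinate in frame `i` does not depend on `i`; hence the anchor
is well defined and smooth. -/
theorem bDefFun_mul_bTransition (Z : Finset Circle) {i j : Option Z} {p : Circle}
    (hi : p ∈ bBaseSet Z i) (hj : p ∈ bBaseSet Z j) :
    bDefFun Z j p * bTransition Z i j p = bDefFun Z i p := by
  by_cases hij : i = j
  · simp [bTransition, hij]
  · have := bDefFun_ne_zero Z j p hj (notMem_of_mem_bBaseSet Z hij hi hj)
    simp only [bTransition, hij, if_false]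
    field_simp

theorem contMDiff_bAngularForm (Z : Finset Circle) :
    ContMDiff ((𝓡 1).prod 𝓘(ℝ, ℝ)) 𝓘(ℝ, ℝ) ∞
      (fun v : TotalSpace ℝ (BTangentSpace Z) => bAngularForm Z v.1 v.2) := by
  intro v₀
  have h1 : ContMDiffAt ((𝓡 1).prod 𝓘(ℝ, ℝ)) 𝓘(ℝ, ℝ) ∞
      (fun v : TotalSpace ℝ (BTangentSpace Z) =>
        (trivializationAt ℝ (BTangentSpace Z) v₀.proj v).2) v₀ :=
    (contMDiffAt_totalSpace.1 contMDiffAt_id).2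
  have h2 : ContMDiffAt ((𝓡 1).prod 𝓘(ℝ, ℝ)) 𝓘(ℝ, ℝ) ∞
      (fun v : TotalSpace ℝ (BTangentSpace Z) =>
        bDefFun Z ((bTangentCore Z).indexAt v₀.proj) v.proj) v₀ :=
    ((contMDiff_bDefFun Z _).comp (contMDiff_proj (BTangentSpace Z))).contMDiffAt
  refine (h2.mul h1).congr_of_eventuallyEq ?_
  filter_upwards [(FiberBundle.continuous_proj ℝ (BTangentSpace Z)).continuousAt.preimage_mem_nhds
    ((bBaseSet_isOpen Z _).mem_nhds ((bTangentCore Z).mem_baseSet_at v₀.proj))] with v hv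
  have h3 := bDefFun_mul_bTransition Z ((bTangentCore Z).mem_baseSet_at v.proj) hv
  rw [bAngularForm_apply, ← h3, mul_assoc]
  rfl

theorem Circle.nontrivial : Nontrivial Circle :=
  ⟨1, Circle.exp Real.pi, fun h => by
    have := congrArg (fun p : Circle => (p : ℂ)) h
    simp at this
    norm_num [Complex.ext_iff] at this⟩

theorem isBTangentBundle_bTangentSpace (Z : Finset Circle) :
    IsBTangentBundle (𝓡 1) (Z : Set Circle) ℝ (BTangentSpace Z) := by
  classical
  refine ⟨fun p => (bAngularForm Z p).smulRight (angularField p),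
    contMDiff_coframe_smul_frame (contMDiff_bAngularForm Z) contMDiff_angularField,
    fun U hU => ⟨fun s hs => ?_, fun s t hs ht hst p hp => ?_, fun X hX => ?_⟩⟩
  · exact isBVectorField_smul_angularField hU (hs.comp_section (contMDiff_bAngularForm Z))
      fun z hz _ => bAngularForm_of_mem hz _
  -- The anchor is injective only off `Z`; at points of `Z` equality of sections follows by
  -- continuity.
  · have hst' : ∀ q ∈ U, q ∉ Z → s q = t q := fun q hq hqZ => by
      have h1 := congrArg (angularForm q) (hst q hq)
      simp only [LinearMap.smulRight_apply, angularForm_smul, bAngularForm_of_notMem hqZ] at h1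
      exact (bFiberEquiv Z q).injective h1
    by_cases hpZ : p ∈ Z
    · have hs' := ((contMDiffAt_section p).1 (hs.contMDiffAt (hU.mem_nhds hp))).continuousAt
      have ht' := ((contMDiffAt_section p).1 (ht.contMDiffAt (hU.mem_nhds hp))).continuousAt
      have hev : ∀ᶠ q in 𝓝[≠] p, (trivializationAt ℝ (BTangentSpace Z) p ⟨q, s q⟩).2 =
          (trivializationAt ℝ (BTangentSpace Z) p ⟨q, t q⟩).2 := by
        rw [eventually_nhdsWithin_iff]
        filter_upwards [eventually_ne_bDefFun Z ⟨p, hpZ⟩, hU.mem_nhds hp] with q hq hqU hqp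
        rw [hst' q hqU (hq hqp).1]
      have := Circle.nontrivial
      have := (hs'.eventuallyEq_nhds_iff_eventuallyEq_nhdsNE ht').1 hev
      have h1 := this.self_of_nhds
      simpa [trivializationAt_bTangentSpace, bTransition] using h1
    · exact hst' p hp hpZ
  · rw [isBVectorField_iff hU] at hX
    obtain ⟨hg, h0⟩ := hX
    set g : Circle → ℝ := fun p => angularForm p (X p) with hgdef
    have key : ∀ z ∈ Z, z ∈ U → ∃ k : Circle → ℝ, ContMDiff (𝓡 1) 𝓘(ℝ, ℝ) ∞ k ∧
        ∀ᶠ p in 𝓝 z, g p = k p * ((p / z : Circle) : ℂ).im :=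
      fun z hz hzU => exists_eq_mul_im_div z (hU.mem_nhds hzU) hg (h0 z hz hzU)
    choose! k hk hgk using key
    -- At `p ∈ Z` the preferred frame stands for `Im (· / p) ∂/∂θ`, so the coordinate is the
    -- Hadamard quotient; off `Z` it is `g` itself.
    refine ⟨fun p => (bFiberEquiv Z p).symm (if p ∈ Z then k p p else g p), fun p hp => ?_, fun p hp => ?_⟩
    · apply ContMDiffAt.contMDiffWithinAt
      rw [contMDiffAt_section]
      simp only [trivializationAt_bTangentSpace, LinearEquiv.apply_symm_apply]
      by_cases hpZ : p ∈ Z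
      · refine (hk p hpZ hp).contMDiffAt.congr_of_eventuallyEq ?_
        filter_upwards [hgk p hpZ hp, eventually_ne_bDefFun Z ⟨p, hpZ⟩] with q hq hqZ
        by_cases hqp : q = p
        · subst hqp
          simp [hpZ, bTransition]
        · obtain ⟨hqZ', hq0⟩ := hqZ hqp
          rw [bTangentCore_indexAt_of_mem Z hpZ, bTangentCore_indexAt_of_notMem Z hqZ']
          simp only [bTransition, hqZ', if_false, reduceCtorEq, hq]
          simp only [bDefFun] at hq0 ⊢
          field_simp
      · refine ((hg p hp).contMDiffAt (hU.mem_nhds hp)).congr_of_eventuallyEq ?_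
        filter_upwards [(bBaseSet_isOpen Z none).mem_nhds hpZ] with q hq
        have hqZ : q ∉ Z := hq
        rw [bTangentCore_indexAt_of_notMem Z hpZ, bTangentCore_indexAt_of_notMem Z hqZ]
        simp [bTransition, hqZ]
    · rw [← angularForm_smul_angularField p (X p), LinearMap.smulRight_apply]
      congr 1
      by_cases hpZ : p ∈ Z
      · rw [bAngularForm_of_mem hpZ, h0 p hpZ hp]
      · rw [bAngularForm_of_notMem hpZ, LinearEquiv.apply_symm_apply, if_neg hpZ]

end BTangent

/-! ### Isomorphism with `TS¹` and defining functions. -/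

section Classification

open Topology

variable {Z : Finset Circle} {F : Type*} [NormedAddCommGroup F] [NormedSpace ℝ F]
  {E : Circle → Type*} [TopologicalSpace (TotalSpace F E)] [∀ p, AddCommGroup (E p)]
  [∀ p, Module ℝ (E p)] [∀ p, TopologicalSpace (E p)] [FiberBundle F E] [VectorBundle ℝ F E]

/-- Pull `∂/∂θ` back to a frame `s` of `E` and let `g` be the coefficient of its anchor. Lifting
each local field `f i ∂/∂θ` to a multiple of `s` shows that `g` divides `f i`, so `g` vanishes no
more than `f i` does. -/
theorem exists_isDefiningFunction_of_isomorphic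
    (hE : IsBTangentBundle (𝓡 1) (Z : Set Circle) F E)
    (hiso : SmoothVectorBundleIsomorphic (𝓡 1) F E
      (EuclideanSpace ℝ (Fin 1)) (fun p : Circle => TangentSpace (𝓡 1) p)) :
    ∃ G, IsDefiningFunction Z G := by
  obtain ⟨ρ, -, hρ⟩ := hE
  obtain ⟨Φ, hΦ, hΦ'⟩ := hiso
  set s : ∀ p, E p := fun p => (Φ p).symm (angularField p) with hsdef
  have hs : ContMDiff (𝓡 1) ((𝓡 1).prod 𝓘(ℝ, F)) ∞ (fun p => TotalSpace.mk' F p (s p)) :=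
    hΦ'.comp contMDiff_angularField
  set g : Circle → ℝ := fun p => angularForm p (ρ p (s p)) with hgdef
  have hg := (isBVectorField_iff isOpen_univ).1 ((hρ univ isOpen_univ).1 s hs.contMDiffOn)
  have key : ∀ i, ∃ h : Circle → ℝ, ContMDiffOn (𝓡 1) 𝓘(ℝ, ℝ) ∞ h (bBaseSet Z i) ∧
      ∀ p ∈ bBaseSet Z i, bDefFun Z i p = h p * g p := by
    intro i
    have hU := bBaseSet_isOpen Z i
    obtain ⟨t, ht, hρt⟩ := (hρ _ hU).2.2 _ (isBVectorField_smul_angularField hU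
      (contMDiff_bDefFun Z i).contMDiffOn fun z hz hzi => by
        cases i with
        | none => exact absurd hz hzi
        | some w =>
          have : z = w.1 := by
            by_contra h
            exact hzi.2 ⟨hz, h⟩
          simp [bDefFun, this])
    refine ⟨fun p => angularForm p (Φ p (t p)),
      (ht.map_section hΦ).angularForm, fun p hp => ?_⟩
    have h1 : t p = angularForm p (Φ p (t p)) • s p := by
      rw [hsdef]
      simp only
      rw [← map_smul, angularForm_smul_angularField, LinearEquiv.symm_apply_apply]
    have h2 := congrArg (angularForm p) (hρt p hp)
    rw [angularForm_smul, h1, map_smul, map_smul] at h2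
    exact h2.symm
  refine ⟨g, contMDiffOn_univ.1 hg.1, fun p hp h0 => ?_, fun z hz => ?_⟩
  · obtain ⟨h, -, hh⟩ := key none
    have := hh p hp
    rw [h0, mul_zero] at this
    exact one_ne_zero this
  · have hg0 : g z = 0 := hg.2 z hz trivial
    obtain ⟨k, hk, hgk⟩ := exists_eq_mul_im_div z Filter.univ_mem hg.1 hg0
    refine ⟨k, hk.contMDiffAt, fun hk0 => ?_, hgk⟩
    obtain ⟨h, hh, heq⟩ := key (some ⟨z, hz⟩)
    have hmem : bBaseSet Z (some ⟨z, hz⟩) ∈ 𝓝 z :=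
      (bBaseSet_isOpen Z _).mem_nhds (by simp [bBaseSet])
    have := Circle.nontrivial
    have hhk : ContinuousAt (fun p => h p * k p) z :=
      (hh.contMDiffAt hmem).continuousAt.mul hk.continuous.continuousAt
    -- Cancelling `Im (p / z)` is possible only off `z`; continuity then gives `h z * k z = 1`.
    have hev : ∀ᶠ p in 𝓝[≠] z, h p * k p = 1 := by
      rw [eventually_nhdsWithin_iff]
      filter_upwards [hmem, hgk, eventually_ne_bDefFun Z ⟨z, hz⟩] with p hp hgp hpz hne
      obtain ⟨-, h0⟩ := hpz hne
      have h1 := heq p hp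
      have h2 : bDefFun Z (some ⟨z, hz⟩) p = ((p / z : Circle) : ℂ).im := rfl
      have h3 : g p = k p * bDefFun Z (some ⟨z, hz⟩) p := hgp
      rw [h3] at h1
      apply mul_right_cancel₀ h0
      rw [one_mul]
      linear_combination -h1
    have h1 := (hhk.eventuallyEq_nhds_iff_eventuallyEq_nhdsNE continuousAt_const).1 hev
    have h2 : h z * k z = 1 := h1.self_of_nhds
    rw [hk0, mul_zero] at h2
    exact zero_ne_one h2

variable [ContMDiffVectorBundle ∞ F E (𝓡 1)]

theorem IsDefiningFunction.isomorphic {G : Circle → ℝ} (hG : IsDefiningFunction Z G)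
    (hE : IsBTangentBundle (𝓡 1) (Z : Set Circle) F E) :
    SmoothVectorBundleIsomorphic (𝓡 1) F E
      (EuclideanSpace ℝ (Fin 1)) (fun p : Circle => TangentSpace (𝓡 1) p) := by
  obtain ⟨ρ, -, hρ⟩ := hE
  obtain ⟨s, hs, hρs⟩ := (hρ univ isOpen_univ).2.2 _ (isBVectorField_smul_angularField isOpen_univ
    hG.contMDiff.contMDiffOn fun z hz _ => hG.eq_zero hz)
  -- Extend `w` to a local section `t`. Its anchor is `h G ∂/∂θ`, the anchor of `h • s`, so `t = h •
  -- s` by injectivity on sections, even at points of `Z` where the anchor vanishes.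
  have hspan : ∀ p (w : E p), ∃ c : ℝ, c • s p = w := by
    intro p w
    obtain ⟨U, hU, hpU, t, rfl, ht⟩ := exists_contMDiffOn_section (𝓡 1) F E p w
    have hg := (isBVectorField_iff hU).1 ((hρ U hU).1 t ht)
    obtain ⟨h, hh, heq⟩ := hG.exists_eq_mul hU hg.1 hg.2
    refine ⟨h p, (hρ U hU).2.1 (h • s) t (hh.smul_section (hs.mono (subset_univ U))) ht
      (fun q hq => ?_) p hpU⟩
    rw [Pi.smul_apply', map_smul, hρs q trivial, smul_smul, ← heq q hq,
      angularForm_smul_angularField]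
  -- A zero of `s` would make one fibre, hence every fibre, trivial, contradicting `G ≠ 0` off `Z`.
  have hs0 : ∀ p, s p ≠ 0 := by
    intro p hp
    have hE0 : ∀ w : E p, w = 0 := fun w => by
      obtain ⟨c, rfl⟩ := hspan p w
      rw [hp, smul_zero]
    obtain ⟨θ, hθ⟩ := (Circle.dense_exp_notMem Z).nonempty
    set q := Circle.exp θ
    have hsq : s q = 0 := by
      have e₁ := VectorBundle.continuousLinearEquivAt ℝ F E p
      have e₂ := VectorBundle.continuousLinearEquivAt ℝ F E q
      apply e₂.injective
      apply e₁.symm.injective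
      rw [hE0 (e₁.symm _), hE0 (e₁.symm (e₂ 0))]
    have h1 := congrArg (angularForm q) (hρs q trivial)
    rw [hsq, map_zero, map_zero, angularForm_smul] at h1
    exact hG.ne_zero q hθ h1.symm
  let e : ∀ p, ℝ ≃ₗ[ℝ] E p := fun p =>
    LinearEquiv.ofBijective (LinearMap.toSpanSingleton ℝ (E p) (s p))
    ⟨LinearMap.ker_eq_bot.1 (LinearMap.ker_toSpanSingleton ℝ (hs0 p)), fun w => hspan p w⟩
  have he : ∀ p c, e p c = c • s p := fun p c => rfl
  exact smoothVectorBundleIsomorphic_of_frames (X := s) (θ := fun p => (e p).symm)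
    (X' := angularField) (θ' := fun p => (angularForm p : TangentSpace (𝓡 1) p →ₗ[ℝ] ℝ))
    (contMDiffOn_univ.1 hs)
    (fun p => (e p).symm_apply_eq.2 (by rw [he, one_smul]))
    (fun p w => by rw [← he]; exact (e p).apply_symm_apply w)
    contMDiff_angularField angularForm_angularField angularForm_smul_angularField

theorem isomorphic_tangentBundle_iff_even_card
    (hE : IsBTangentBundle (𝓡 1) (Z : Set Circle) F E) :
    SmoothVectorBundleIsomorphic (𝓡 1) F E
      (EuclideanSpace ℝ (Fin 1)) (fun p : Circle => TangentSpace (𝓡 1) p) ↔ Even Z.card := by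
  refine ⟨fun h => ?_, fun ⟨n, hn⟩ => ?_⟩
  · obtain ⟨G, hG⟩ := exists_isDefiningFunction_of_isomorphic hE h
    exact hG.even_card
  · obtain ⟨G, hG⟩ := exists_isDefiningFunction n Z hn
    exact hG.isomorphic hE

end Classification

theorem mainTheorem7 (Z : Finset Circle) :
    IsBTangentBundle (𝓡 1) (Z : Set Circle) ℝ (BTangentSpace Z) ∧
    (SmoothVectorBundleIsomorphic (𝓡 1) ℝ (BTangentSpace Z)
      (EuclideanSpace ℝ (Fin 1)) (fun p : Circle => TangentSpace (𝓡 1) p) ↔ Even Z.card) ∧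
    ∀ (F : Type*) [NormedAddCommGroup F] [NormedSpace ℝ F] [FiniteDimensional ℝ F]
      (E : Circle → Type*) [TopologicalSpace (TotalSpace F E)] [∀ p, AddCommGroup (E p)]
      [∀ p, Module ℝ (E p)] [∀ p, TopologicalSpace (E p)] [FiberBundle F E] [VectorBundle ℝ F E]
      [ContMDiffVectorBundle ∞ F E (𝓡 1)],
      IsBTangentBundle (𝓡 1) (Z : Set Circle) F E →
        (SmoothVectorBundleIsomorphic (𝓡 1) F E
          (EuclideanSpace ℝ (Fin 1)) (fun p : Circle => TangentSpace (𝓡 1) p) ↔ Even Z.card) := by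
  refine ⟨isBTangentBundle_bTangentSpace Z,
    isomorphic_tangentBundle_iff_even_card (isBTangentBundle_bTangentSpace Z), ?_⟩
  intro F _ _ _ E _ _ _ _ _ _ _ hE
  exact isomorphic_tangentBundle_iff_even_card hE
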